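/- Let $\big(Y_1(t),Y_2(t)\big)^\top$, $t\ge 0$, be the two-dimensional real stationary Ornstein–Uhlenbeck process with damping parameter $\lambda>0$, frequency $\omega\neq 0$ and $\sigma>0$, that is, the centred stationary Gaussian process solving $$\mathrm d\begin{bmatrix}Y_1(t)\\Y_2(t)\end{bmatrix}=\begin{bmatrix}-\lambda&-\omega\\ \omega&-\lambda\end{bmatrix}\begin{bmatrix}Y_1(t)\\Y_2(t)\end{bmatrix}\mathrm dt+\sigma\begin{bmatrix}\mathrm d\mathcal W_1(t)\\ \mathrm d\mathcal W_2(t)\end{bmatrix}$$ with independent standard Brownian motions $\mathcal W_1,\mathcal W_2$; its law is determined by $$\mathsf E\begin{bmatrix}Y_1(t+\tau)\\Y_2(t+\tau)\end{bmatrix}\begin{bmatrix}Y_1(t)\\Y_2(t)\end{bmatrix}^{\top}=\frac{\sigma^2}{2\lambda}\,\mathrm e^{-\lambda\tau}\begin{bmatrix}\cos(\omega\tau)&-\sin(\omega\tau)\\ \sin(\omega\tau)&\cos(\omega\tau)\end{bmatrix},\qquad t,\tau\ge 0 .$$ Normalize $\sigma^2=2\lambda$ for all parameter values, so that $Y_1(t),Y_2(t)$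 have variance one. For constants $m_1,m_2\in\mathbb R$ let $Z_1(t)=m_1+Y_1(t)$, $Z_2(t)=m_2+Y_2(t)$, and let $C(n)=C(n;\lambda,\omega)$ be the $2n\times 2n$ covariance matrix of the observations $\big(Z_1(t_1),Z_2(t_1),\dots,Z_1(t_n),Z_2(t_n)\big)^\top$ in design points $0\le t_1<t_2<\dots<t_n$. The Fisher information matrix of this Gaussian observation vector on the covariance parameters $(\lambda,\omega)$ is $$\mathcal I_{\lambda,\omega}(n)=\begin{bmatrix}\mathcal I_\lambda(n)& I_{\lambda,\omega}(n)\\ I_{\lambda,\omega}(n)&\mathcal I_\omega(n)\end{bmatrix},$$ with entries defined by $$\mathcal I_\lambda(n)=\tfrac12\operatorname{tr}\Big\{C^{-1}(n)\tfrac{\partial C(n)}{\partial\lambda}C^{-1}(n)\tfrac{\partial C(n)}{\partial\lambda}\Big\},\quad \mathcal I_\omega(n)=\tfrac12\operatorname{tr}\Big\{C^{-1}(n)\tfrac{\partial C(n)}{\partial\omega}C^{-1}(n)\tfrac{\partial C(n)}{\partial\omega}\Big\},$$ $$I_{\lambda,\omega}(n)=\tfrac12\operatorname{tr}\Big\{C^{-1}(n)\tfrac{\partial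 C(n)}{\partial\lambda}C^{-1}(n)\tfrac{\partial C(n)}{\partial\omega}\Big\}.$$ Then $C(n)$ is positive definite and its entries have partial derivatives with respect to $\lambda$ and $\omega$, and, with $d_\ell=t_{\ell+1}-t_\ell$, $\ell=1,\dots,n-1$, $$\mathcal I_\lambda(n)=\sum_{\ell=1}^{n-1}\varphi(d_\ell),\qquad \mathcal I_\omega(n)=\sum_{\ell=1}^{n-1}\psi(d_\ell),\qquad I_{\lambda,\omega}(n)=0,$$ where $$\varphi(x)=\frac{x^2\mathrm e^{-\lambda x}\cosh(\lambda x)}{\sinh^2(\lambda x)},\qquad \psi(x)=\frac{x^2\mathrm e^{-\lambda x}}{\sinh(\lambda x)}\qquad (x>0),\qquad \varphi(0)=\frac1{\lambda^2},\quad\psi(0)=0 .$$ In particular the matrix $\mathcal I_{\lambda,\omega}(n)$ does not depend on $\omega$. -/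

import Mathlib

open MeasureTheory ProbabilityTheory
open scoped NNReal

noncomputable section

/-- The matrix `σ² / (2 λ) · e^{-λ τ} · [[cos (ω τ), -sin (ω τ)], [sin (ω τ), cos (ω τ)]]`, i.e.
`σ² / (2 λ) · e^{A τ}` with `A = [[-λ, -ω], [ω, -λ]]`, for `τ ≥ 0`. -/
def ouCov (lam om sigma : ℝ) (τ : ℝ≥0) : Matrix (Fin 2) (Fin 2) ℝ :=
  (sigma ^ 2 / (2 * lam) * Real.exp (-lam * τ)) •
    !![Real.cos (om * τ), -Real.sin (om * τ); Real.sin (om * τ), Real.cos (om * τ)]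

/-- `Y` is (under `P`) a two-dimensional stationary Ornstein–Uhlenbeck process with damping
parameter `λ`, frequency `ω` and standard deviation `σ`, i.e. it has the finite-dimensional
distributions of the stationary solution of `dY = A Y dt + σ dW`: it is a centred Gaussian process
with `E [Y(t + τ) Y(t)ᵀ] = σ² / (2 λ) · e^{A τ}` for all `t, τ ≥ 0`. -/
structure IsStationaryOU {Ω : Type*} [MeasurableSpace Ω] (lam om sigma : ℝ)
    (Y : ℝ≥0 → Ω → EuclideanSpace ℝ (Fin 2)) (P : Measure Ω) : Prop where
  gaussian : IsGaussianProcess Y P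
  centered : ∀ (t : ℝ≥0) (i : Fin 2), ∫ w, Y t w i ∂P = 0
  cov_eq : ∀ (t τ : ℝ≥0) (i j : Fin 2),
    ∫ w, Y (t + τ) w i * Y t w j ∂P = ouCov lam om sigma τ i j

/-- The process with constant trend `m`: `Z₁(t) = m₁ + Y₁(t)`, `Z₂(t) = m₂ + Y₂(t)`. -/
def constTrend {Ω : Type*} (m : EuclideanSpace ℝ (Fin 2))
    (Y : ℝ≥0 → Ω → EuclideanSpace ℝ (Fin 2)) (t : ℝ≥0) (w : Ω) : EuclideanSpace ℝ (Fin 2) :=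
  m + Y t w

/-- The `2n × 2n` covariance matrix of the observations
`(Z₁(t₁), Z₂(t₁), …, Z₁(tₙ), Z₂(tₙ))`; the index `(j, i)` stands for the entry `Zᵢ(tⱼ)`. -/
def obsCov {Ω : Type*} [MeasurableSpace Ω] {n : ℕ} (Z : ℝ≥0 → Ω → EuclideanSpace ℝ (Fin 2))
    (P : Measure Ω) (t : Fin n → ℝ≥0) : Matrix (Fin n × Fin 2) (Fin n × Fin 2) ℝ :=
  Matrix.of fun p q => covariance (fun w => Z (t p.1) w p.2) (fun w => Z (t q.1) w q.2) P

/-- The partial derivative of a matrix function of `(λ, ω)` with respect to `λ`. -/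
def matDerivLam {ι : Type*} (C : ℝ → ℝ → Matrix ι ι ℝ) (lam om : ℝ) : Matrix ι ι ℝ :=
  Matrix.of fun p q => deriv (fun l => C l om p q) lam

/-- The partial derivative of a matrix function of `(λ, ω)` with respect to `ω`. -/
def matDerivOm {ι : Type*} (C : ℝ → ℝ → Matrix ι ι ℝ) (lam om : ℝ) : Matrix ι ι ℝ :=
  Matrix.of fun p q => deriv (fun o => C lam o p q) om

/-- `1/2 · tr (C⁻¹ C₁ C⁻¹ C₂)`. -/
def fisherEntry {ι : Type*} [Fintype ι] [DecidableEq ι] (C C₁ C₂ : Matrix ι ι ℝ) : ℝ :=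
  1 / 2 * (C⁻¹ * C₁ * C⁻¹ * C₂).trace

/-- The Fisher information matrix on the covariance parameters `(λ, ω)` of a Gaussian observation
vector with covariance matrix `C λ ω`. -/
def fisherMatrix {ι : Type*} [Fintype ι] [DecidableEq ι] (C : ℝ → ℝ → Matrix ι ι ℝ)
    (lam om : ℝ) : Matrix (Fin 2) (Fin 2) ℝ :=
  !![fisherEntry (C lam om) (matDerivLam C lam om) (matDerivLam C lam om),
     fisherEntry (C lam om) (matDerivLam C lam om) (matDerivOm C lam om);
     fisherEntry (C lam om) (matDerivLam C lam om) (matDerivOm C lam om),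
     fisherEntry (C lam om) (matDerivOm C lam om) (matDerivOm C lam om)]

/-- The distance of the consecutive design points with the (zero-based) numbers `ℓ`, `ℓ + 1`. -/
def gap {n : ℕ} (t : Fin n → ℝ≥0) (l : Fin (n - 1)) : ℝ :=
  (t ⟨l.1 + 1, by omega⟩ : ℝ) - (t ⟨l.1, by omega⟩ : ℝ)

/-- `φ(x) = x² e^{-λ x} cosh (λ x) / sinh² (λ x)` for `x > 0`, and `φ(0) = 1 / λ²`. -/
def phiOU (lam x : ℝ) : ℝ :=
  if x = 0 then 1 / lam ^ 2
  else x ^ 2 * Real.exp (-lam * x) * Real.cosh (lam * x) / Real.sinh (lam * x) ^ 2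

/-- `ψ(x) = x² e^{-λ x} / sinh (λ x)` for `x > 0`, and `ψ(0) = 0`. -/
def psiOU (lam x : ℝ) : ℝ :=
  if x = 0 then 0 else x ^ 2 * Real.exp (-lam * x) / Real.sinh (lam * x)

end

/-!
Identify the plane with `ℂ`: up to the scalar kernel `exp (-λ |s - t|)`, the covariance of the
process is the rotation by `ω (s - t)`. Splitting this angle into `ω s` and `-ω t` writes the
covariance matrix of the observations as the congruence transform, by a block diagonal matrix of
rotations, of the Kronecker product of the scalar kernel matrix with the identity. Its derivatives
are transforms by the *same* matrix: with the scalar kernel times `-|s - t|` for `λ`, and with the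
scalar kernel times `s - t`, tensored with a quarter turn, for `ω`. The trace defining the
information is invariant under congruence, so `ω` disappears, and the mixed entry vanishes because
a quarter turn has trace `0`.

What remains is scalar. By the Markov property, the regression of a new observation on the earlier
ones only involves the last of them, so a unitriangular congruence splits the new observation off.
It contributes an amount that only depends on its distance from the last design point, and
induction on the number of points gives the two sums.
-/

open Matrix
open scoped Kronecker

theorem trace_fromBlocks_eq {ι κ R : Type*} [Fintype ι] [Fintype κ] [AddCommMonoid R]
    (A : Matrix ι ι R) (B : Matrix ι κ R) (C : Matrix κ ι R) (D : Matrix κ κ R) :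
    (fromBlocks A B C D).trace = A.trace + D.trace := by
  simp [trace]

section FisherEntry

variable {ι κ : Type*} [Fintype ι] [DecidableEq ι] [Fintype κ] [DecidableEq κ]

theorem fisherEntry_congruence {L : Matrix ι ι ℝ} (hL : IsUnit L) (K A B : Matrix ι ι ℝ) :
    fisherEntry (L * K * Lᵀ) (L * A * Lᵀ) (L * B * Lᵀ) = fisherEntry K A B := by
  have hdet : IsUnit L.det := (isUnit_iff_isUnit_det L).1 hL
  have hdetT : IsUnit Lᵀ.det := by rwa [det_transpose]
  have hconj : (L * K * Lᵀ)⁻¹ * (L * A * Lᵀ) * (L * K * Lᵀ)⁻¹ * (L * B * Lᵀ) =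
      Lᵀ⁻¹ * (K⁻¹ * A * K⁻¹ * B * Lᵀ) := by
    simp only [Matrix.mul_inv_rev, Matrix.mul_assoc]
    simp only [nonsing_inv_mul_cancel_left _ _ hdet, mul_nonsing_inv_cancel_left _ _ hdetT]
  rw [fisherEntry, fisherEntry, hconj, trace_mul_comm, mul_nonsing_inv_cancel_right _ _ hdetT]

theorem fisherEntry_submatrix_equiv (e : κ ≃ ι) (K A B : Matrix ι ι ℝ) :
    fisherEntry (K.submatrix e e) (A.submatrix e e) (B.submatrix e e) = fisherEntry K A B := by
  simp only [fisherEntry, inv_submatrix_equiv, submatrix_mul_equiv]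
  congr 1
  exact e.sum_comp fun i => (K⁻¹ * A * K⁻¹ * B) i i

theorem fisherEntry_kronecker (K A B : Matrix ι ι ℝ) (M X Y : Matrix κ κ ℝ) :
    fisherEntry (K ⊗ₖ M) (A ⊗ₖ X) (B ⊗ₖ Y) = 2 * fisherEntry K A B * fisherEntry M X Y := by
  simp only [fisherEntry, inv_kronecker, ← mul_kronecker_mul, trace_kronecker]
  ring

theorem fisherEntry_fromBlocks_diagonal {K : Matrix ι ι ℝ} {D : Matrix κ κ ℝ} (hK : IsUnit K)
    (hD : IsUnit D) (A : Matrix ι ι ℝ) (B : Matrix ι κ ℝ) (C : Matrix κ ι ℝ) (W : Matrix κ κ ℝ) :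
    fisherEntry (fromBlocks K 0 0 D) (fromBlocks A B C W) (fromBlocks A B C W) =
      fisherEntry K A A + (K⁻¹ * B * D⁻¹ * C).trace + fisherEntry D W W := by
  have hcyc : (D⁻¹ * C * K⁻¹ * B).trace = (K⁻¹ * B * D⁻¹ * C).trace := by
    rw [Matrix.mul_assoc (D⁻¹ * C), trace_mul_comm, ← Matrix.mul_assoc]
  rw [fisherEntry, inv_fromBlocks_zero₁₂_of_isUnit_iff _ _ _ (iff_of_true hK hD)]
  simp only [fromBlocks_multiply, Matrix.zero_mul, Matrix.mul_zero, neg_zero, add_zero, zero_add,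
    trace_fromBlocks_eq, trace_add, hcyc, fisherEntry]
  ring

theorem fisherEntry_border {K : Matrix ι ι ℝ} (hK : IsUnit K) {s : ℝ} (hs : s ≠ 0)
    (A : Matrix ι ι ℝ) (x : ι) (b c w : ℝ) :
    fisherEntry (fromBlocks K 0 0 (s • (1 : Matrix (Fin 1) (Fin 1) ℝ)))
        (fromBlocks A (K * single x 0 b) (single 0 x c * K) (w • 1))
        (fromBlocks A (K * single x 0 b) (single 0 x c * K) (w • 1)) =
      fisherEntry K A A + b * c * K x x / s + w ^ 2 / (2 * s ^ 2) := by
  have hdet : IsUnit K.det := (isUnit_iff_isUnit_det K).1 hK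
  have hs1 : IsUnit (s • (1 : Matrix (Fin 1) (Fin 1) ℝ)) :=
    (isUnit_iff_isUnit_det _).2 (by simp [hs])
  have hinv : (s • (1 : Matrix (Fin 1) (Fin 1) ℝ))⁻¹ = s⁻¹ • 1 :=
    inv_eq_left_inv (by simp [smul_smul, hs])
  have hcross : (K⁻¹ * (K * (single x 0 b : Matrix ι (Fin 1) ℝ)) *
      (s⁻¹ • (1 : Matrix (Fin 1) (Fin 1) ℝ)) *
        ((single 0 x c : Matrix (Fin 1) ι ℝ) * K)).trace = b * c * K x x / s := by
    rw [nonsing_inv_mul_cancel_left _ _ hdet, Matrix.mul_smul, Matrix.mul_one, Matrix.smul_mul,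
      ← Matrix.mul_assoc, single_mul_single_same, trace_smul, trace_single_mul]
    rw [smul_eq_mul, smul_eq_mul, div_eq_inv_mul]
  have hcorner : fisherEntry (s • (1 : Matrix (Fin 1) (Fin 1) ℝ)) (w • 1) (w • 1) =
      w ^ 2 / (2 * s ^ 2) := by
    simp only [fisherEntry, hinv, mul_smul_comm, mul_one, trace_smul, trace_one,
      Fintype.card_unique, Nat.cast_one, smul_eq_mul]
    field_simp
  rw [fisherEntry_fromBlocks_diagonal hK hs1, hinv, hcross, hcorner]

end FisherEntry

open scoped ComplexOrder in
theorem posDef_fromBlocks_diagonal {ι κ 𝕜 : Type*} [Finite ι] [Finite κ] [RCLike 𝕜]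
    {A : Matrix ι ι 𝕜} {D : Matrix κ κ 𝕜} (hA : A.PosDef) (hD : D.PosDef) :
    (fromBlocks A 0 0 D).PosDef := by
  classical
  have := Fintype.ofFinite ι
  have := Fintype.ofFinite κ
  have := hA.isUnit.invertible
  have hsemi : (fromBlocks A 0 0 D).PosSemidef := by
    simpa using (hA.fromBlocks₁₁ 0 D).2 (by simpa using hD.posSemidef)
  exact hsemi.posDef_iff_isUnit.2 (isUnit_fromBlocks_zero₁₂.2 ⟨hA.isUnit, hD.isUnit⟩)

theorem posDef_congruence {ι : Type*} [Fintype ι] [DecidableEq ι] {L K : Matrix ι ι ℝ}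
    (hL : IsUnit L) (hK : K.PosDef) : (L * K * Lᵀ).PosDef := by
  simpa [star_eq_conjTranspose] using (IsUnit.posDef_star_right_conjugate_iff hL).2 hK

theorem unitriangular_congruence {ι κ R : Type*} [Fintype ι] [DecidableEq ι] [Fintype κ]
    [DecidableEq κ] [CommSemiring R] (P : Matrix κ ι R) (A : Matrix ι ι R) (B : Matrix ι κ R)
    (C : Matrix κ ι R) (W : Matrix κ κ R) :
    fromBlocks 1 0 P 1 * fromBlocks A B C W * (fromBlocks 1 0 P 1)ᵀ =
      fromBlocks A (A * Pᵀ + B) (P * A + C) ((P * A + C) * Pᵀ + (P * B + W)) := by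
  simp [fromBlocks_transpose, fromBlocks_multiply]

section Kernel

variable {ι : Type*}

/-- The correlation matrix of a one-dimensional stationary Ornstein–Uhlenbeck process with damping
parameter `lam`, observed at the points `t`. -/
noncomputable def ouKernel (lam : ℝ) (t : ι → ℝ) : Matrix ι ι ℝ :=
  of fun p q => Real.exp (-(lam * |t p - t q|))

/-- The matrix `ouKernel lam t` with every entry multiplied by `u` times the positive part plus `v`
times the negative part of the time lag. Both derivatives of the two-dimensional covariance are
built on it: `u = v = -1` for the damping and `u = 1`, `v = -1` for the frequency. -/
noncomputable def lagKernel (u v lam : ℝ) (t : ι → ℝ) : Matrix ι ι ℝ :=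
  of fun p q => (u * (t p - t q)⁺ + v * (t p - t q)⁻) * ouKernel lam t p q

/-- The information on a change of `ouKernel lam t` in the direction `lagKernel u v lam t` that is
gained by one further observation at distance `d` from the last one. -/
noncomputable def lagInformation (u v lam d : ℝ) : ℝ :=
  u * v * (d * Real.exp (-(lam * d))) ^ 2 / (1 - Real.exp (-(lam * d)) ^ 2) +
    ((u + v) * d * Real.exp (-(lam * d)) ^ 2) ^ 2 / (2 * (1 - Real.exp (-(lam * d)) ^ 2) ^ 2)

/-- The unitriangular matrix that adds to a last coordinate, indexed by `Sum.inr 0`, the multiple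
`a` of the coordinate `x`. -/
def addLast [DecidableEq ι] (x : ι) (a : ℝ) : Matrix (ι ⊕ Fin 1) (ι ⊕ Fin 1) ℝ :=
  fromBlocks 1 0 (single 0 x a) 1

theorem isUnit_addLast [Fintype ι] [DecidableEq ι] (x : ι) (a : ℝ) : IsUnit (addLast x a) :=
  isUnit_fromBlocks_zero₁₂.2 ⟨isUnit_one, isUnit_one⟩

theorem ouKernel_eq_one_of_subsingleton [Subsingleton ι] [DecidableEq ι] (lam : ℝ) (t : ι → ℝ) :
    ouKernel lam t = 1 := by
  ext i j
  obtain rfl := Subsingleton.elim i j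
  simp [ouKernel]

theorem lagKernel_eq_zero_of_subsingleton [Subsingleton ι] (u v lam : ℝ) (t : ι → ℝ) :
    lagKernel u v lam t = 0 := by
  ext i j
  simp [lagKernel, Subsingleton.elim i j]

theorem exp_neg_mul_abs_sub_add (lam : ℝ) {p q d : ℝ} (hpq : p ≤ q) (hd : 0 ≤ d) :
    Real.exp (-(lam * |p - (q + d)|)) = Real.exp (-(lam * d)) * Real.exp (-(lam * |p - q|)) := by
  rw [abs_of_nonpos (by linarith), abs_of_nonpos (by linarith), ← Real.exp_add]
  ring_nf

variable [Fintype ι] [DecidableEq ι] {t : ι → ℝ} {x : ι} {d : ℝ}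

/- The Markov property of the process in matrix form: the regression of a new observation on the
earlier ones only involves the last of them. -/
theorem ouKernel_append (lam : ℝ) (hx : ∀ i, t i ≤ t x) (hd : 0 ≤ d) :
    ouKernel lam (Sum.elim t fun _ : Fin 1 => t x + d) =
      addLast x (Real.exp (-(lam * d))) *
        fromBlocks (ouKernel lam t) 0 0 ((1 - Real.exp (-(lam * d)) ^ 2) • 1) *
        (addLast x (Real.exp (-(lam * d))))ᵀ := by
  rw [addLast, unitriangular_congruence]
  ext (i | i) (j | j)
  · rfl
  · have h := exp_neg_mul_abs_sub_add lam (hx i) hd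
    simp [ouKernel, h, Subsingleton.elim j 0, mul_comm]
  · have h := exp_neg_mul_abs_sub_add lam (hx j) hd
    simp [ouKernel, h, Subsingleton.elim i 0, abs_sub_comm (t x), abs_sub_comm (t x + d)]
  · simp only [ouKernel, Subsingleton.elim i 0, Subsingleton.elim j 0, of_apply, Sum.elim_inr,
      sub_self, abs_zero, mul_zero, neg_zero, Real.exp_zero, transpose_single, add_zero,
      single_mul_mul_single, mul_one, Matrix.mul_zero, zero_add, fromBlocks_apply₂₂,
      Matrix.add_apply, single_apply_same, Matrix.smul_apply, one_apply_eq, smul_eq_mul]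
    ring

theorem lagKernel_append (u v lam : ℝ) (hx : ∀ i, t i ≤ t x) (hd : 0 ≤ d) :
    lagKernel u v lam (Sum.elim t fun _ : Fin 1 => t x + d) =
      addLast x (Real.exp (-(lam * d))) *
        fromBlocks (lagKernel u v lam t)
          (ouKernel lam t * single x 0 (v * (d * Real.exp (-(lam * d)))))
          (single 0 x (u * (d * Real.exp (-(lam * d)))) * ouKernel lam t)
          (-((u + v) * d * Real.exp (-(lam * d)) ^ 2) • 1) *
        (addLast x (Real.exp (-(lam * d))))ᵀ := by
  rw [addLast, unitriangular_congruence]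
  ext (i | i) (j | j)
  · rfl
  · have h := exp_neg_mul_abs_sub_add lam (hx i) hd
    have h1 : t i - (t x + d) ≤ 0 := by linarith [hx i]
    have h2 : t i - t x ≤ 0 := by linarith [hx i]
    simp only [lagKernel, ouKernel, of_apply, Subsingleton.elim j 0, Sum.elim_inl, Sum.elim_inr,
      posPart_of_nonpos h1, posPart_of_nonpos h2, negPart_of_nonpos h1, negPart_of_nonpos h2,
      mul_zero, neg_sub, zero_add, h, transpose_single, fromBlocks_apply₁₂, Matrix.add_apply,
      mul_single_apply_same]
    ring
  · have h := exp_neg_mul_abs_sub_add lam (hx j) hd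
    have h1 : 0 ≤ t x + d - t j := by linarith [hx j]
    have h2 : 0 ≤ t x - t j := by linarith [hx j]
    simp only [lagKernel, ouKernel, of_apply, Subsingleton.elim i 0, Sum.elim_inl, Sum.elim_inr,
      posPart_of_nonneg h1, posPart_of_nonneg h2, negPart_of_nonneg h1, negPart_of_nonneg h2,
      mul_zero, add_zero, abs_sub_comm (t x + d), abs_sub_comm (t x), h, fromBlocks_apply₂₁,
      Matrix.add_apply, single_mul_apply_same]
    ring
  · simp only [lagKernel, ouKernel, of_apply, Subsingleton.elim i 0, Subsingleton.elim j 0,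
      Sum.elim_inr, sub_self, posPart_zero, negPart_zero, mul_zero, neg_zero, add_zero, abs_zero,
      Real.exp_zero, mul_one, transpose_single, fromBlocks_apply₂₂, Matrix.add_apply,
      mul_single_apply_same, single_mul_apply_same, zero_add, one_mul, Matrix.smul_apply,
      one_apply_eq, smul_eq_mul]
    ring

theorem one_sub_exp_sq_pos {y : ℝ} (hy : 0 < y) : 0 < 1 - Real.exp (-y) ^ 2 := by
  have : Real.exp (-y) < 1 := Real.exp_lt_one_iff.2 (by linarith)
  nlinarith [Real.exp_pos (-y)]

theorem fisherEntry_lagKernel_append (u v : ℝ) {lam : ℝ} (hlam : 0 < lam) (hx : ∀ i, t i ≤ t x)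
    (hd : 0 < d) (hK : IsUnit (ouKernel lam t)) :
    fisherEntry (ouKernel lam (Sum.elim t fun _ : Fin 1 => t x + d))
        (lagKernel u v lam (Sum.elim t fun _ : Fin 1 => t x + d))
        (lagKernel u v lam (Sum.elim t fun _ : Fin 1 => t x + d)) =
      fisherEntry (ouKernel lam t) (lagKernel u v lam t) (lagKernel u v lam t) +
        lagInformation u v lam d := by
  have hvar := (one_sub_exp_sq_pos (mul_pos hlam hd)).ne'
  have hdiag : ouKernel lam t x x = 1 := by simp [ouKernel]
  rw [ouKernel_append lam hx hd.le, lagKernel_append u v lam hx hd.le,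
    fisherEntry_congruence (isUnit_addLast _ _), fisherEntry_border hK hvar, hdiag, lagInformation]
  ring

end Kernel

theorem posDef_ouKernel_append {ι : Type*} [Finite ι] {t : ι → ℝ} {x : ι} {lam d : ℝ}
    (hlam : 0 < lam) (hx : ∀ i, t i ≤ t x) (hd : 0 < d) (hK : (ouKernel lam t).PosDef) :
    (ouKernel lam (Sum.elim t fun _ : Fin 1 => t x + d)).PosDef := by
  classical
  have := Fintype.ofFinite ι
  rw [ouKernel_append lam hx hd.le]
  exact posDef_congruence (isUnit_addLast _ _)
    (posDef_fromBlocks_diagonal hK (PosDef.one.smul (one_sub_exp_sq_pos (mul_pos hlam hd))))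

section DesignPoints

theorem comp_finSumFinEquiv_eq_elim {n : ℕ} (t : Fin (n + 2) → ℝ) :
    t ∘ finSumFinEquiv (m := n + 1) (n := 1) =
      Sum.elim (t ∘ Fin.castSucc)
        fun _ => (t ∘ Fin.castSucc) (Fin.last n) + (t (Fin.last _) - t (Fin.last n).castSucc) := by
  ext (i | i)
  · rfl
  · rw [Subsingleton.elim i 0]
    exact (add_sub_cancel _ _).symm

theorem posDef_ouKernel_succ {lam : ℝ} (hlam : 0 < lam) :
    ∀ {n : ℕ} {t : Fin (n + 1) → ℝ}, StrictMono t → (ouKernel lam t).PosDef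
  | 0, t, _ => ouKernel_eq_one_of_subsingleton (ι := Fin 1) lam t ▸ PosDef.one
  | n + 1, t, ht => by
    have hlast := posDef_ouKernel_append (t := t ∘ Fin.castSucc) (x := Fin.last n) hlam
      (fun i => ht.monotone (Fin.castSucc_le_castSucc_iff.2 i.le_last))
      (sub_pos.2 (ht (Fin.castSucc_lt_last (Fin.last n))))
      (posDef_ouKernel_succ hlam (ht.comp Fin.strictMono_castSucc))
    rw [← comp_finSumFinEquiv_eq_elim] at hlast
    simpa [ouKernel, submatrix] using hlast.submatrix finSumFinEquiv.symm.injective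

theorem posDef_ouKernel {lam : ℝ} (hlam : 0 < lam) {n : ℕ} {t : Fin n → ℝ} (ht : StrictMono t) :
    (ouKernel lam t).PosDef := by
  cases n with
  | zero => exact ouKernel_eq_one_of_subsingleton lam t ▸ PosDef.one
  | succ n => exact posDef_ouKernel_succ hlam ht

theorem fisherEntry_lagKernel_succ (u v : ℝ) {lam : ℝ} (hlam : 0 < lam) :
    ∀ {n : ℕ} {t : Fin (n + 1) → ℝ}, StrictMono t →
      fisherEntry (ouKernel lam t) (lagKernel u v lam t) (lagKernel u v lam t) =
        ∑ l : Fin n, lagInformation u v lam (t l.succ - t l.castSucc)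
  | 0, t, _ => by
    simp [lagKernel_eq_zero_of_subsingleton (ι := Fin 1) u v lam t, fisherEntry]
  | n + 1, t, ht => by
    have hpos := ht.comp (Fin.strictMono_castSucc (n := n + 1))
    have hlast := fisherEntry_lagKernel_append (t := t ∘ Fin.castSucc) (x := Fin.last n) u v hlam
      (fun i => ht.monotone (Fin.castSucc_le_castSucc_iff.2 i.le_last))
      (sub_pos.2 (ht (Fin.castSucc_lt_last (Fin.last n)))) (posDef_ouKernel hlam hpos).isUnit
    rw [← comp_finSumFinEquiv_eq_elim, fisherEntry_lagKernel_succ u v hlam hpos] at hlast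
    rw [Fin.sum_univ_castSucc]
    exact (fisherEntry_submatrix_equiv finSumFinEquiv _ _ _).symm.trans hlast

theorem fisherEntry_lagKernel (u v : ℝ) {lam : ℝ} (hlam : 0 < lam) {n : ℕ} {t : Fin n → ℝ}
    (ht : StrictMono t) :
    fisherEntry (ouKernel lam t) (lagKernel u v lam t) (lagKernel u v lam t) =
      ∑ l : Fin (n - 1), lagInformation u v lam (t ⟨l.1 + 1, by omega⟩ - t ⟨l.1, by omega⟩) := by
  cases n with
  | zero => simp [fisherEntry]
  | succ n => exact fisherEntry_lagKernel_succ u v hlam ht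

theorem phiOU_eq_lagInformation {lam d : ℝ} (hlam : 0 < lam) (hd : 0 < d) :
    phiOU lam d = 2 * lagInformation (-1) (-1) lam d := by
  have hvar := (one_sub_exp_sq_pos (mul_pos hlam hd)).ne'
  have hexp := (Real.exp_pos (-(lam * d))).ne'
  rw [phiOU, if_neg hd.ne', Real.cosh_eq, Real.sinh_eq, neg_mul, lagInformation,
    show Real.exp (lam * d) = (Real.exp (-(lam * d)))⁻¹ by rw [Real.exp_neg, inv_inv]]
  generalize Real.exp (-(lam * d)) = a at *
  field_simp
  ring

theorem psiOU_eq_lagInformation {lam d : ℝ} (hlam : 0 < lam) (hd : 0 < d) :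
    psiOU lam d = -2 * lagInformation 1 (-1) lam d := by
  have hvar := (one_sub_exp_sq_pos (mul_pos hlam hd)).ne'
  have hexp := (Real.exp_pos (-(lam * d))).ne'
  rw [psiOU, if_neg hd.ne', Real.sinh_eq, neg_mul, lagInformation,
    show Real.exp (lam * d) = (Real.exp (-(lam * d)))⁻¹ by rw [Real.exp_neg, inv_inv]]
  generalize Real.exp (-(lam * d)) = a at *
  field_simp
  ring

end DesignPoints

section Plane

/-- The rotation matrix of the plane by the angle `θ`. -/
noncomputable def planeRot (θ : ℝ) : Matrix (Fin 2) (Fin 2) ℝ :=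
  !![Real.cos θ, -Real.sin θ; Real.sin θ, Real.cos θ]

theorem planeRot_mul (α β : ℝ) : planeRot α * planeRot β = planeRot (α + β) := by
  simp only [planeRot, mul_fin_two, Real.cos_add, Real.sin_add]
  ring_nf

theorem planeRot_transpose (α : ℝ) : (planeRot α)ᵀ = planeRot (-α) := by
  ext i j
  fin_cases i <;> fin_cases j <;> simp [planeRot]

theorem planeRot_zero : planeRot 0 = 1 := by
  ext i j
  fin_cases i <;> fin_cases j <;> simp [planeRot]

theorem trace_planeRot (α : ℝ) : (planeRot α).trace = 2 * Real.cos α := by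
  simp [planeRot, trace_fin_two, two_mul]

theorem hasDerivAt_planeRot (θ : ℝ) (i j : Fin 2) :
    HasDerivAt (fun x => planeRot x i j) (planeRot (θ + Real.pi / 2) i j) θ := by
  fin_cases i <;> fin_cases j <;>
    simp [planeRot, Real.cos_add_pi_div_two, Real.sin_add_pi_div_two, Real.hasDerivAt_sin,
      Real.hasDerivAt_cos, (Real.hasDerivAt_sin θ).fun_neg]

theorem fisherEntry_planeRot (α β : ℝ) :
    fisherEntry (planeRot 0) (planeRot α) (planeRot β) = Real.cos (α + β) := by
  simp [fisherEntry, planeRot_zero, planeRot_mul, trace_planeRot]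

variable {ι : Type*}

/-- The matrix whose `2 × 2` block at `(p, q)` is `M p q` times the rotation by the angle
`θ p - θ q + α`. -/
noncomputable def rotatedKernel (θ : ι → ℝ) (α : ℝ) (M : Matrix ι ι ℝ) :
    Matrix (ι × Fin 2) (ι × Fin 2) ℝ :=
  of fun p q => M p.1 q.1 * planeRot (θ p.1 - θ q.1 + α) p.2 q.2

variable [DecidableEq ι]

/-- The block diagonal matrix that rotates the plane with index `p` by the angle `θ p`. -/
noncomputable def blockRot (θ : ι → ℝ) : Matrix (ι × Fin 2) (ι × Fin 2) ℝ :=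
  of fun p q => if p.1 = q.1 then planeRot (θ p.1) p.2 q.2 else 0

variable [Fintype ι]

theorem isUnit_blockRot (θ : ι → ℝ) : IsUnit (blockRot θ) := by
  refine IsUnit.of_mul_eq_one (blockRot fun p => -θ p) ?_
  ext ⟨p, i⟩ ⟨q, j⟩
  have hcancel := congrFun₂ (planeRot_mul (θ p) (-θ p)) i j
  rw [add_neg_cancel, planeRot_zero, mul_apply] at hcancel
  by_cases hpq : p = q
  · subst hpq
    simpa [blockRot, mul_apply, Fintype.sum_prod_type, one_apply] using hcancel
  · simp [blockRot, mul_apply, Fintype.sum_prod_type, hpq]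

theorem rotatedKernel_eq_congruence (θ : ι → ℝ) (α : ℝ) (M : Matrix ι ι ℝ) :
    rotatedKernel θ α M = blockRot θ * (M ⊗ₖ planeRot α) * (blockRot θ)ᵀ := by
  ext ⟨p, i⟩ ⟨q, j⟩
  have hrot : planeRot (θ p - θ q + α) = planeRot (θ p) * planeRot α * (planeRot (θ q))ᵀ := by
    rw [planeRot_transpose, planeRot_mul, planeRot_mul]
    ring_nf
  simp only [rotatedKernel, of_apply, hrot, mul_apply, Fin.sum_univ_two, transpose_apply, blockRot,
    kroneckerMap_apply, ite_mul, zero_mul, Fintype.sum_prod_type, Finset.sum_ite_irrel,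
    Finset.sum_const_zero, Finset.sum_ite_eq, Finset.mem_univ, ↓reduceIte, mul_ite, mul_zero]
  ring

theorem fisherEntry_rotatedKernel (θ : ι → ℝ) (α β : ℝ) (K A B : Matrix ι ι ℝ) :
    fisherEntry (rotatedKernel θ 0 K) (rotatedKernel θ α A) (rotatedKernel θ β B) =
      2 * fisherEntry K A B * Real.cos (α + β) := by
  rw [rotatedKernel_eq_congruence, rotatedKernel_eq_congruence, rotatedKernel_eq_congruence,
    fisherEntry_congruence (isUnit_blockRot θ), fisherEntry_kronecker, fisherEntry_planeRot]

end Plane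

theorem posDef_rotatedKernel {ι : Type*} [Finite ι] (θ : ι → ℝ) {K : Matrix ι ι ℝ}
    (hK : K.PosDef) : (rotatedKernel θ 0 K).PosDef := by
  classical
  have := Fintype.ofFinite ι
  rw [rotatedKernel_eq_congruence, planeRot_zero]
  exact posDef_congruence (isUnit_blockRot θ) (hK.kronecker PosDef.one)

section Correlation

variable {ι : Type*}

/-- The correlation matrix of a two-dimensional stationary Ornstein–Uhlenbeck process with damping
parameter `lam` and frequency `om`, observed at the points `t`. -/
noncomputable def ouCorr (lam om : ℝ) (t : ι → ℝ) : Matrix (ι × Fin 2) (ι × Fin 2) ℝ :=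
  of fun p q => Real.exp (-(lam * |t p.1 - t q.1|)) * planeRot (om * (t p.1 - t q.1)) p.2 q.2

theorem ouCorr_eq_rotatedKernel (lam om : ℝ) (t : ι → ℝ) :
    ouCorr lam om t = rotatedKernel (om • t) 0 (ouKernel lam t) := by
  ext p q
  simp [ouCorr, rotatedKernel, ouKernel, mul_sub]

theorem hasDerivAt_ouCorr_lam (lam om : ℝ) (t : ι → ℝ) (p q : ι × Fin 2) :
    HasDerivAt (fun l => ouCorr l om t p q)
      (rotatedKernel (om • t) 0 (lagKernel (-1) (-1) lam t) p q) lam := by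
  have hexp : HasDerivAt (fun l => Real.exp (-(l * |t p.1 - t q.1|)))
      (Real.exp (-(lam * |t p.1 - t q.1|)) * -(1 * |t p.1 - t q.1|)) lam :=
    ((hasDerivAt_id lam).mul_const _).fun_neg.exp
  refine (hexp.mul_const (planeRot (om * (t p.1 - t q.1)) p.2 q.2)).congr_deriv ?_
  have hlag : |t p.1 - t q.1| = (t p.1 - t q.1)⁺ + (t p.1 - t q.1)⁻ :=
    (posPart_add_negPart _).symm
  simp only [rotatedKernel, lagKernel, ouKernel, of_apply, Pi.smul_apply, smul_eq_mul, add_zero,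
    ← mul_sub]
  linear_combination
    -Real.exp (-(lam * |t p.1 - t q.1|)) * planeRot (om * (t p.1 - t q.1)) p.2 q.2 * hlag

theorem hasDerivAt_ouCorr_om (lam om : ℝ) (t : ι → ℝ) (p q : ι × Fin 2) :
    HasDerivAt (fun o => ouCorr lam o t p q)
      (rotatedKernel (om • t) (Real.pi / 2) (lagKernel 1 (-1) lam t) p q) om := by
  have hrot := (hasDerivAt_planeRot (om * (t p.1 - t q.1)) p.2 q.2).comp om
    ((hasDerivAt_id om).mul_const (t p.1 - t q.1))
  refine (hrot.const_mul (Real.exp (-(lam * |t p.1 - t q.1|)))).congr_deriv ?_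
  have hlag : (t p.1 - t q.1)⁺ - (t p.1 - t q.1)⁻ = t p.1 - t q.1 := posPart_sub_negPart _
  simp only [rotatedKernel, lagKernel, ouKernel, of_apply, Pi.smul_apply, smul_eq_mul, ← mul_sub]
  linear_combination -Real.exp (-(lam * |t p.1 - t q.1|)) *
    planeRot (om * (t p.1 - t q.1) + Real.pi / 2) p.2 q.2 * hlag

variable {n : ℕ} {t : Fin n → ℝ} {lam : ℝ}

theorem posDef_ouCorr (hlam : 0 < lam) (om : ℝ) (ht : StrictMono t) :
    (ouCorr lam om t).PosDef :=
  ouCorr_eq_rotatedKernel lam om t ▸ posDef_rotatedKernel _ (posDef_ouKernel hlam ht)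

theorem fisherEntry_ouCorr_lam (hlam : 0 < lam) (om : ℝ) (ht : StrictMono t) :
    fisherEntry (ouCorr lam om t) (rotatedKernel (om • t) 0 (lagKernel (-1) (-1) lam t))
        (rotatedKernel (om • t) 0 (lagKernel (-1) (-1) lam t)) =
      ∑ l : Fin (n - 1), phiOU lam (t ⟨l.1 + 1, by omega⟩ - t ⟨l.1, by omega⟩) := by
  rw [ouCorr_eq_rotatedKernel, fisherEntry_rotatedKernel, fisherEntry_lagKernel _ _ hlam ht,
    add_zero, Real.cos_zero, mul_one, Finset.mul_sum]
  exact Finset.sum_congr rfl fun l _ =>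
    (phiOU_eq_lagInformation hlam (sub_pos.2 (ht (Fin.mk_lt_mk.2 l.1.lt_succ_self)))).symm

theorem fisherEntry_ouCorr_om (hlam : 0 < lam) (om : ℝ) (ht : StrictMono t) :
    fisherEntry (ouCorr lam om t)
        (rotatedKernel (om • t) (Real.pi / 2) (lagKernel 1 (-1) lam t))
        (rotatedKernel (om • t) (Real.pi / 2) (lagKernel 1 (-1) lam t)) =
      ∑ l : Fin (n - 1), psiOU lam (t ⟨l.1 + 1, by omega⟩ - t ⟨l.1, by omega⟩) := by
  rw [ouCorr_eq_rotatedKernel, fisherEntry_rotatedKernel, fisherEntry_lagKernel _ _ hlam ht,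
    add_halves, Real.cos_pi, mul_neg_one, ← neg_mul, Finset.mul_sum]
  exact Finset.sum_congr rfl fun l _ =>
    (psiOU_eq_lagInformation hlam (sub_pos.2 (ht (Fin.mk_lt_mk.2 l.1.lt_succ_self)))).symm

theorem fisherEntry_ouCorr_lam_om [Fintype ι] [DecidableEq ι] (lam om : ℝ) (t : ι → ℝ) :
    fisherEntry (ouCorr lam om t) (rotatedKernel (om • t) 0 (lagKernel (-1) (-1) lam t))
      (rotatedKernel (om • t) (Real.pi / 2) (lagKernel 1 (-1) lam t)) = 0 := by
  rw [ouCorr_eq_rotatedKernel, fisherEntry_rotatedKernel, zero_add, Real.cos_pi_div_two, mul_zero]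

end Correlation

section Covariance

variable {Ω : Type*} [MeasurableSpace Ω] {P : Measure Ω} {lam om sigma : ℝ}
  {Y : ℝ≥0 → Ω → EuclideanSpace ℝ (Fin 2)}

theorem ouCov_sub_apply (lam om sigma : ℝ) {s u : ℝ≥0} (hsu : s ≤ u) (i j : Fin 2) :
    ouCov lam om sigma (u - s) i j = sigma ^ 2 / (2 * lam) *
      (Real.exp (-(lam * |(u : ℝ) - s|)) * planeRot (om * ((u : ℝ) - s)) i j) := by
  have habs : |(u : ℝ) - s| = u - s := abs_of_nonneg (sub_nonneg.2 (NNReal.coe_le_coe.2 hsu))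
  rw [habs, ← NNReal.coe_sub hsu, ← neg_mul, ← mul_assoc]
  rfl

theorem IsStationaryOU.integrable (hY : IsStationaryOU lam om sigma Y P) (s : ℝ≥0) (i : Fin 2) :
    Integrable (fun w => Y s w i) P :=
  (hY.gaussian.hasGaussianLaw_eval s).integrable.eval_piLp i

theorem IsStationaryOU.covariance_eq_ouCov (hY : IsStationaryOU lam om sigma Y P) {s u : ℝ≥0}
    (hsu : s ≤ u) (i j : Fin 2) :
    cov[fun w => Y u w i, fun w => Y s w j; P] = ouCov lam om sigma (u - s) i j := by
  rw [← hY.cov_eq s (u - s) i j, add_tsub_cancel_of_le hsu]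
  simp [covariance, hY.centered]

theorem IsStationaryOU.covariance_eq (hY : IsStationaryOU lam om sigma Y P) (s u : ℝ≥0)
    (i j : Fin 2) :
    cov[fun w => Y u w i, fun w => Y s w j; P] = sigma ^ 2 / (2 * lam) *
      (Real.exp (-(lam * |(u : ℝ) - s|)) * planeRot (om * ((u : ℝ) - s)) i j) := by
  rcases le_total s u with h | h
  · rw [hY.covariance_eq_ouCov h, ouCov_sub_apply _ _ _ h]
  · rw [covariance_comm, hY.covariance_eq_ouCov h, ouCov_sub_apply _ _ _ h, abs_sub_comm,
      ← transpose_apply (planeRot _), planeRot_transpose, ← mul_neg om, neg_sub]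

theorem IsStationaryOU.obsCov_constTrend (hY : IsStationaryOU lam om sigma Y P)
    (m : EuclideanSpace ℝ (Fin 2)) {n : ℕ} (t : Fin n → ℝ≥0) :
    obsCov (constTrend m Y) P t =
      (sigma ^ 2 / (2 * lam)) • ouCorr lam om fun p => (t p : ℝ) := by
  have := hY.gaussian.isProbabilityMeasure
  ext p q
  simp only [obsCov, constTrend, of_apply, PiLp.add_apply]
  rw [covariance_const_add_left (hY.integrable _ _), covariance_const_add_right (hY.integrable _ _),
    hY.covariance_eq]
  rfl

theorem IsStationaryOU.obsCov_constTrend_eq_ouCorr (hlam : 0 < lam)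
    (hY : IsStationaryOU lam om (Real.sqrt (2 * lam)) Y P) (m : EuclideanSpace ℝ (Fin 2)) {n : ℕ}
    (t : Fin n → ℝ≥0) :
    obsCov (constTrend m Y) P t = ouCorr lam om fun p => (t p : ℝ) := by
  have h : 0 < 2 * lam := by linarith
  rw [hY.obsCov_constTrend, Real.sq_sqrt h.le, div_self h.ne', one_smul]

end Covariance

section ParameterFamily

variable {ι : Type*} {C : ℝ → ℝ → Matrix (ι × Fin 2) (ι × Fin 2) ℝ} {t : ι → ℝ} {U : Set ℝ}
  {lam om : ℝ}

theorem hasDerivAt_lam_of_eq_ouCorr (hC : ∀ l > 0, ∀ o ∈ U, C l o = ouCorr l o t)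
    (hlam : 0 < lam) (hom : om ∈ U) (p q : ι × Fin 2) :
    HasDerivAt (fun l => C l om p q)
      (rotatedKernel (om • t) 0 (lagKernel (-1) (-1) lam t) p q) lam := by
  refine (hasDerivAt_ouCorr_lam lam om t p q).congr_of_eventuallyEq ?_
  filter_upwards [lt_mem_nhds hlam] with l hl
  rw [hC l hl om hom]

theorem hasDerivAt_om_of_eq_ouCorr (hU : IsOpen U) (hC : ∀ l > 0, ∀ o ∈ U, C l o = ouCorr l o t)
    (hlam : 0 < lam) (hom : om ∈ U) (p q : ι × Fin 2) :
    HasDerivAt (fun o => C lam o p q)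
      (rotatedKernel (om • t) (Real.pi / 2) (lagKernel 1 (-1) lam t) p q) om := by
  refine (hasDerivAt_ouCorr_om lam om t p q).congr_of_eventuallyEq ?_
  filter_upwards [hU.mem_nhds hom] with o ho
  rw [hC lam hlam o ho]

theorem matDerivLam_of_eq_ouCorr (hC : ∀ l > 0, ∀ o ∈ U, C l o = ouCorr l o t) (hlam : 0 < lam)
    (hom : om ∈ U) :
    matDerivLam C lam om = rotatedKernel (om • t) 0 (lagKernel (-1) (-1) lam t) :=
  ext fun p q => (hasDerivAt_lam_of_eq_ouCorr hC hlam hom p q).deriv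

theorem matDerivOm_of_eq_ouCorr (hU : IsOpen U) (hC : ∀ l > 0, ∀ o ∈ U, C l o = ouCorr l o t)
    (hlam : 0 < lam) (hom : om ∈ U) :
    matDerivOm C lam om = rotatedKernel (om • t) (Real.pi / 2) (lagKernel 1 (-1) lam t) :=
  ext fun p q => (hasDerivAt_om_of_eq_ouCorr hU hC hlam hom p q).deriv

end ParameterFamily

theorem theorem2_general {n : ℕ} {t : Fin n → ℝ} (ht : StrictMono t)
    {C : ℝ → ℝ → Matrix (Fin n × Fin 2) (Fin n × Fin 2) ℝ} {U : Set ℝ} (hU : IsOpen U)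
    (hC : ∀ l > 0, ∀ o ∈ U, C l o = ouCorr l o t) {lam om : ℝ} (hlam : 0 < lam) (hom : om ∈ U) :
    (C lam om).PosDef ∧
    (∀ p q, DifferentiableAt ℝ (fun l => C l om p q) lam ∧
      DifferentiableAt ℝ (fun o => C lam o p q) om) ∧
    fisherEntry (C lam om) (matDerivLam C lam om) (matDerivLam C lam om) =
      ∑ l : Fin (n - 1), phiOU lam (t ⟨l.1 + 1, by omega⟩ - t ⟨l.1, by omega⟩) ∧
    fisherEntry (C lam om) (matDerivOm C lam om) (matDerivOm C lam om) =
      ∑ l : Fin (n - 1), psiOU lam (t ⟨l.1 + 1, by omega⟩ - t ⟨l.1, by omega⟩) ∧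
    fisherEntry (C lam om) (matDerivLam C lam om) (matDerivOm C lam om) = 0 ∧
    ∀ om' ∈ U, fisherMatrix C lam om' = fisherMatrix C lam om := by
  have hLam : ∀ o ∈ U, fisherEntry (C lam o) (matDerivLam C lam o) (matDerivLam C lam o) =
      ∑ l : Fin (n - 1), phiOU lam (t ⟨l.1 + 1, by omega⟩ - t ⟨l.1, by omega⟩) := fun o ho => by
    rw [hC lam hlam o ho, matDerivLam_of_eq_ouCorr hC hlam ho, fisherEntry_ouCorr_lam hlam o ht]
  have hOm : ∀ o ∈ U, fisherEntry (C lam o) (matDerivOm C lam o) (matDerivOm C lam o) =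
      ∑ l : Fin (n - 1), psiOU lam (t ⟨l.1 + 1, by omega⟩ - t ⟨l.1, by omega⟩) := fun o ho => by
    rw [hC lam hlam o ho, matDerivOm_of_eq_ouCorr hU hC hlam ho, fisherEntry_ouCorr_om hlam o ht]
  have hLamOm : ∀ o ∈ U, fisherEntry (C lam o) (matDerivLam C lam o) (matDerivOm C lam o) = 0 :=
    fun o ho => by
      rw [hC lam hlam o ho, matDerivLam_of_eq_ouCorr hC hlam ho,
        matDerivOm_of_eq_ouCorr hU hC hlam ho, fisherEntry_ouCorr_lam_om]
  have hdiff : ∀ p q, DifferentiableAt ℝ (fun l => C l om p q) lam ∧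
      DifferentiableAt ℝ (fun o => C lam o p q) om := fun p q =>
    ⟨(hasDerivAt_lam_of_eq_ouCorr hC hlam hom p q).differentiableAt,
      (hasDerivAt_om_of_eq_ouCorr hU hC hlam hom p q).differentiableAt⟩
  refine ⟨hC lam hlam om hom ▸ posDef_ouCorr hlam om ht, hdiff, hLam om hom, hOm om hom,
    hLamOm om hom, fun om' hom' => ?_⟩
  rw [fisherMatrix, fisherMatrix, hLam om hom, hLam om' hom', hOm om hom, hOm om' hom',
    hLamOm om hom, hLamOm om' hom']

/-- For every `λ > 0`, `ω ≠ 0` let `Y λ ω` be, under `P λ ω`, a stationary OU process with these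
parameters and `σ² / (2 λ) = 1`, and let `C λ ω` be the covariance matrix of the observations of
`m + Y λ ω` in the design points `t`. -/
theorem theorem2 {Ω : Type*} [MeasurableSpace Ω] (P : ℝ → ℝ → Measure Ω)
    (Y : ℝ → ℝ → ℝ≥0 → Ω → EuclideanSpace ℝ (Fin 2))
    (hY : ∀ l o : ℝ, 0 < l → o ≠ 0 → IsStationaryOU l o (Real.sqrt (2 * l)) (Y l o) (P l o))
    (m : EuclideanSpace ℝ (Fin 2)) (n : ℕ) (t : Fin n → ℝ≥0) (ht : StrictMono t)
    (C : ℝ → ℝ → Matrix (Fin n × Fin 2) (Fin n × Fin 2) ℝ)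
    (hC : C = fun l o => obsCov (constTrend m (Y l o)) (P l o) t)
    (lam om : ℝ) (hlam : 0 < lam) (hom : om ≠ 0) :
    -- the quantities that enter the information matrix are well defined
    (C lam om).PosDef ∧
    (∀ p q, DifferentiableAt ℝ (fun l => C l om p q) lam ∧
      DifferentiableAt ℝ (fun o => C lam o p q) om) ∧
    -- the entries of the information matrix
    fisherEntry (C lam om) (matDerivLam C lam om) (matDerivLam C lam om) =
      ∑ l : Fin (n - 1), phiOU lam (gap t l) ∧
    fisherEntry (C lam om) (matDerivOm C lam om) (matDerivOm C lam om) =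
      ∑ l : Fin (n - 1), psiOU lam (gap t l) ∧
    fisherEntry (C lam om) (matDerivLam C lam om) (matDerivOm C lam om) = 0 ∧
    -- the information matrix does not depend on the frequency
    (∀ om' : ℝ, om' ≠ 0 → fisherMatrix C lam om' = fisherMatrix C lam om) := by
  exact theorem2_general (fun _ _ h => ht h) isOpen_compl_singleton
    (fun l hl o ho => hC ▸ (hY l o hl ho).obsCov_constTrend_eq_ouCorr hl m t) hlam hom
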